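/- Let $\mathbb{K}$ be a field and let $A$ be an associative unital $\mathbb{K}$-algebra which is a pre-commutative skew PBW extension of $\mathbb{K}$ in elements $x_1,\dots,x_n\in A$ ($n \ge 0$). That is: the standard monomials $x^\alpha = x_1^{\alpha_1}\cdots x_n^{\alpha_n}$, $\alpha\in\mathbb{N}^n$, form a $\mathbb{K}$-basis of $A$; for every $i$ and every $r\in\mathbb{K}\setminus\{0\}$ there is $c_{i,r}\in\mathbb{K}\setminus\{0\}$ with $x_i r - c_{i,r}x_i\in\mathbb{K}$; and for all $1\le i,j\le n$ there is $c_{i,j}\in\mathbb{K}\setminus\{0\}$ with $$x_jx_i - c_{i,j}x_ix_j\in \mathbb{K}x_1+\cdots+\mathbb{K}x_n .$$ Let $F_m(A)$ be the $\mathbb{K}$-span of the $x^\alpha$ with $|\alpha| = \alpha_1+\cdots+\alpha_n\le m$ for $m\ge 0$, and $F_{-1}(A)=0$; this is a ring filtration of $A$. Let $\mathrm{Gr}(A)=\bigoplus_{m\ge 0}F_m(A)/F_{m-1}(A)$ be the associated graded ring. Then $\mathrm{Gr}(A)$ is homogeneous Koszul. Here a graded $\mathbb{K}$-algebra $B=\bigoplus_{m\ge0}B_m$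 is called homogeneous Koszul if 1. (homogeneous pre-Koszul) $B$ is isomorphic, as a graded algebra, to $\mathbb{K}\langle y_1,\dots,y_p\rangle/I$ for some $p \ge 0$, where the free algebra is graded by word length and $I$ is a two-sided ideal generated by elements of the form $\sum_{1\le j,k\le p} c_{j,k}\,y_jy_k$ with $c_{j,k}\in\mathbb{K}$; and 2. the trivial left $B$-module $\mathbb{K}=B/\bigoplus_{m>0}B_m$ has a linear free resolution, i.e. an exact sequence $\cdots\to P_2\to P_1\to P_0\to\mathbb{K}\to 0$ of graded left $B$-modules and degree-preserving $B$-linear maps in which each $P_i$ is a graded free module with a homogeneous basis in degree $i$. -/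

import Mathlib

open scoped DirectSum

/-! ## Skew PBW extensions

The base ring `R` sits in `A` through `r ↦ r • 1`; when `A` is an algebra over a field `K` this is
`algebraMap K A`. -/

namespace SkewPBW

section Extension

variable {R A : Type*} [Ring R] [Ring A] [Module R A] {n : ℕ}

/-- The standard monomial `x₁^α₁ ⋯ xₙ^αₙ` (product in this order). -/
def stdMonomial (x : Fin n → A) (α : Fin n → ℕ) : A :=
  (List.ofFn fun i => x i ^ α i).prod

variable (R) in
/-- `A` is a skew PBW extension of `R` in the generators `x₁, …, xₙ`. -/
structure IsSkewPBWExtension [IsScalarTower R A A] (x : Fin n → A) : Prop where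
  /-- The standard monomials are left linearly independent over `R` (and pairwise distinct). -/
  linearIndependent : LinearIndependent R (stdMonomial x)
  /-- The standard monomials span `A` as a left `R`-module. -/
  span_eq_top : Submodule.span R (Set.range (stdMonomial x)) = ⊤
  /-- `xᵢ r - c xᵢ ∈ R` for some `c ≠ 0`. -/
  mul_scalar : ∀ (i : Fin n) (r : R), r ≠ 0 →
    ∃ c : R, c ≠ 0 ∧ ∃ s : R, x i * (r • (1 : A)) - c • x i = s • (1 : A)
  /-- `xⱼ xᵢ - c xᵢ xⱼ ∈ R + R x₁ + ⋯ + R xₙ` for some `c ≠ 0`. -/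
  mul_gen : ∀ i j : Fin n, ∃ c : R, c ≠ 0 ∧
    x j * x i - c • (x i * x j) ∈ Submodule.span R (insert (1 : A) (Set.range x))

variable (R) in
/-- A skew PBW extension is pre-commutative if the relations between the generators have no
constant term: `xⱼ xᵢ - c xᵢ xⱼ ∈ R x₁ + ⋯ + R xₙ` for some `c ≠ 0`. -/
structure IsPreCommutative [IsScalarTower R A A] (x : Fin n → A) : Prop
    extends IsSkewPBWExtension R x where
  mul_gen_pre : ∀ i j : Fin n, ∃ c : R, c ≠ 0 ∧
    x j * x i - c • (x i * x j) ∈ Submodule.span R (Set.range x)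

variable (R) in
/-- The degree filtration: `F_m(A)` consists of the elements of degree at most `m`, that is, of the
`R`-combinations of standard monomials `x^α` with `|α| = α₁ + ⋯ + αₙ ≤ m`. In particular
`F_0(A) = R`. -/
def degreeFiltration (x : Fin n → A) (m : ℕ) : Submodule R A :=
  Submodule.span R (stdMonomial x '' {α | ∑ i, α i ≤ m})

end Extension

/-! ## The associated graded ring of a filtered algebra -/

section Graded

variable {K A : Type*} [CommRing K] [Ring A] [Algebra K A]

/-- The previous step `F_{m-1}` of a filtration `F_0 ⊆ F_1 ⊆ ⋯`, where `F_{-1} = 0`. -/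
def prevStep (F : ℕ → Submodule K A) : ℕ → Submodule K A
  | 0 => ⊥
  | m + 1 => F m

/-- `Gr(A)_m = F_m / F_{m-1}`. -/
def GrPiece (F : ℕ → Submodule K A) (m : ℕ) : Type _ :=
  F m ⧸ (prevStep F m).submoduleOf (F m)

instance grAddCommGroup (F : ℕ → Submodule K A) (m : ℕ) : AddCommGroup (GrPiece F m) :=
  inferInstanceAs (AddCommGroup (F m ⧸ (prevStep F m).submoduleOf (F m)))

instance grModule (F : ℕ → Submodule K A) (m : ℕ) : Module K (GrPiece F m) :=
  inferInstanceAs (Module K (F m ⧸ (prevStep F m).submoduleOf (F m)))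

/-- The associated graded ring `Gr(A) = ⨁ₘ F_m / F_{m-1}` (as a module). -/
abbrev Gr (F : ℕ → Submodule K A) : Type _ := ⨁ m, GrPiece F m

/-- The `m`-th homogeneous component of `Gr(A)`, as a submodule of `Gr(A)`. -/
def grGrading (F : ℕ → Submodule K A) (m : ℕ) : Submodule K (Gr F) :=
  LinearMap.range (DirectSum.lof K ℕ (GrPiece F) m)

variable (F : ℕ → Submodule K A)

lemma isRingFiltration_of (hmono : Monotone F) (hone : (1 : A) ∈ F 0)
    (hmul : ∀ i j (a b : A), a ∈ F i → b ∈ F j → a * b ∈ F (i + j)) :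
    IsRingFiltration F (prevStep F) where
  mono := hmono
  is_le {i j} h := by
    cases j with
    | zero => omega
    | succ j => exact hmono (Nat.lt_succ_iff.mp h)
  is_sup B j h := by
    cases j with
    | zero => exact bot_le
    | succ j => exact h j (Nat.lt_succ_self j)
  one_mem := hone
  mul_mem _ _ _ _ ha hb := hmul _ _ _ _ ha hb

/-- The class in `F_m / F_{m-1}` of an element of `F_m`. -/
def grMk (m : ℕ) : F m →ₗ[K] GrPiece F m := ((prevStep F m).submoduleOf (F m)).mkQ

lemma grMk_surjective (m : ℕ) : Function.Surjective (grMk F m) := Submodule.mkQ_surjective _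

lemma grMk_sigma_eq {i j : ℕ} (h : i = j) (a : F i) (b : F j) (hab : (a : A) = b) :
    (GradedMonoid.mk i (grMk F i a) : GradedMonoid (GrPiece F)) =
      GradedMonoid.mk j (grMk F j b) := by
  subst h
  rw [Subtype.ext hab]

end Graded

section GradedRing

variable {K A : Type*} [CommRing K] [Ring A] [Algebra K A]
variable (F : ℕ → Submodule K A) [IsRingFiltration F (prevStep F)]

lemma mul_prevStep_mem {i j : ℕ} {a b : A} (ha : a ∈ F i) (hb : b ∈ prevStep F j) :
    a * b ∈ prevStep F (i + j) := by
  cases j with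
  | zero => rw [(Submodule.mem_bot K).1 hb, mul_zero]; exact zero_mem _
  | succ j => exact SetLike.mul_mem_graded (A := F) ha hb

lemma prevStep_mul_mem {i j : ℕ} {a b : A} (ha : a ∈ prevStep F i) (hb : b ∈ F j) :
    a * b ∈ prevStep F (i + j) := by
  cases i with
  | zero => rw [(Submodule.mem_bot K).1 ha, zero_mul]; exact zero_mem _
  | succ i =>
    rw [Nat.succ_add_eq_add_succ, Nat.add_succ]
    exact SetLike.mul_mem_graded (A := F) ha hb

/-- The multiplication `F_i / F_{i-1} × F_j / F_{j-1} → F_{i+j} / F_{i+j-1}`,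
`(ā, b̄) ↦ class of a b`. -/
def grMul (i j : ℕ) : GrPiece F i →ₗ[K] GrPiece F j →ₗ[K] GrPiece F (i + j) :=
  Submodule.liftQ _
    (LinearMap.flip (Submodule.liftQ ((prevStep F j).submoduleOf (F j))
      (LinearMap.flip (LinearMap.mk₂ K
        (fun (a : F i) (b : F j) =>
          grMk F (i + j) ⟨(a : A) * (b : A), SetLike.mul_mem_graded a.2 b.2⟩)
        (fun a a' b => by rw [← map_add]; congr 1; ext; simp [add_mul])
        (fun c a b => by rw [← map_smul]; congr 1; ext; simp)
        (fun a b b' => by rw [← map_add]; congr 1; ext; simp [mul_add])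
        (fun c a b => by rw [← map_smul]; congr 1; ext; simp)))
      (fun b hb => LinearMap.mem_ker.2 <| LinearMap.ext fun a =>
        (Submodule.Quotient.mk_eq_zero _).2 (mul_prevStep_mem F a.2 hb))))
    (fun a ha => LinearMap.mem_ker.2 <| LinearMap.ext fun b => by
      obtain ⟨b, rfl⟩ := Submodule.mkQ_surjective _ b
      exact (Submodule.Quotient.mk_eq_zero _).2 (prevStep_mul_mem F ha b.2))

lemma grMul_mk {i j : ℕ} (a : F i) (b : F j) :
    grMul F i j (grMk F i a) (grMk F j b) =
      grMk F (i + j) ⟨(a : A) * (b : A), SetLike.mul_mem_graded a.2 b.2⟩ := rfl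

instance grGMul : GradedMonoid.GMul (GrPiece F) where
  mul {i j} a b := grMul F i j a b

instance grGOne : GradedMonoid.GOne (GrPiece F) where
  one := grMk F 0 ⟨1, SetLike.one_mem_graded F⟩

instance grGRing : DirectSum.GRing (GrPiece F) where
  mul_zero a := map_zero _
  zero_mul b := LinearMap.map_zero₂ (grMul F _ _) b
  mul_add a b c := map_add _ _ _
  add_mul a b c := LinearMap.map_add₂ (grMul F _ _) a b c
  one_mul := by
    rintro ⟨i, a⟩
    obtain ⟨a, rfl⟩ := grMk_surjective F i a
    exact grMk_sigma_eq F (zero_add i) _ _ (one_mul _)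
  mul_one := by
    rintro ⟨i, a⟩
    obtain ⟨a, rfl⟩ := grMk_surjective F i a
    exact grMk_sigma_eq F (add_zero i) _ _ (mul_one _)
  mul_assoc := by
    rintro ⟨i, a⟩ ⟨j, b⟩ ⟨k, c⟩
    obtain ⟨a, rfl⟩ := grMk_surjective F i a
    obtain ⟨b, rfl⟩ := grMk_surjective F j b
    obtain ⟨c, rfl⟩ := grMk_surjective F k c
    exact grMk_sigma_eq F (add_assoc i j k) _ _ (mul_assoc _ _ _)
  natCast m := m • grMk F 0 ⟨1, SetLike.one_mem_graded F⟩
  natCast_zero := zero_smul _ _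
  natCast_succ m := succ_nsmul _ _
  intCast m := m • grMk F 0 ⟨1, SetLike.one_mem_graded F⟩
  intCast_ofNat m := natCast_zsmul _ _
  intCast_negSucc_ofNat m := negSucc_zsmul _ _

instance grGAlgebra : DirectSum.GAlgebra K (GrPiece F) where
  toFun := (LinearMap.toSpanSingleton K (GrPiece F 0)
    (grMk F 0 ⟨1, SetLike.one_mem_graded F⟩)).toAddMonoidHom
  map_one := one_smul K (grMk F 0 ⟨1, SetLike.one_mem_graded F⟩)
  map_mul r s := by
    refine grMk_sigma_eq F (i := 0) (j := 0 + 0) rfl ((r * s) • ⟨1, SetLike.one_mem_graded F⟩)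
      ⟨(r • (1 : A)) * (s • (1 : A)), _⟩ ?_
    change (r * s) • (1 : A) = (r • (1 : A)) * (s • (1 : A))
    rw [smul_mul_smul_comm, one_mul]
  commutes r := by
    rintro ⟨i, a⟩
    obtain ⟨a, rfl⟩ := grMk_surjective F i a
    refine grMk_sigma_eq F (i := 0 + i) (j := i + 0) (by simp) ⟨(r • (1 : A)) * a, _⟩
      ⟨a * (r • (1 : A)), _⟩ ?_
    simp
  smul_def r := by
    rintro ⟨i, a⟩
    obtain ⟨a, rfl⟩ := grMk_surjective F i a
    refine grMk_sigma_eq F (i := i) (j := 0 + i) (by simp) (r • a) ⟨(r • (1 : A)) * a, _⟩ ?_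
    simp

end GradedRing

/-! ## The degree filtration is multiplicative -/

section DegreeFiltration

variable {K A : Type*} [Field K] [Ring A] [Algebra K A] {n : ℕ}

lemma degreeFiltration_mono (x : Fin n → A) : Monotone (degreeFiltration K x) := fun _ _ h =>
  Submodule.span_mono (Set.image_mono fun _ hα => le_trans hα h)

variable (K) in
/-- The span of all words in the generators of length less than `m`. -/
def wordsLT (x : Fin n → A) (m : ℕ) : Submodule K A :=
  Submodule.span K {a | ∃ w : List (Fin n), w.length < m ∧ (w.map x).prod = a}

lemma word_mem {x : Fin n → A} {m : ℕ} (w : List (Fin n)) (h : w.length < m) :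
    (w.map x).prod ∈ wordsLT K x m := Submodule.subset_span ⟨w, h, rfl⟩

lemma gen_mul_words {x : Fin n → A} {m : ℕ} (i : Fin n) {a : A}
    (ha : a ∈ wordsLT K x m) : x i * a ∈ wordsLT K x (m + 1) := by
  induction ha using Submodule.span_induction with
  | mem a h =>
    obtain ⟨w, hw, rfl⟩ := h
    have := word_mem (K := K) (x := x) (m := m + 1) (i :: w) (by simpa using hw)
    simpa using this
  | zero => simp
  | add a b _ _ ha hb => rw [mul_add]; exact add_mem ha hb
  | smul c a _ ha => rw [mul_smul_comm]; exact Submodule.smul_mem _ _ ha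

lemma words_mono {x : Fin n → A} {m k : ℕ} (h : m ≤ k) :
    wordsLT K x m ≤ wordsLT K x k :=
  Submodule.span_mono fun _ ⟨w, hw, e⟩ => ⟨w, hw.trans_le h, e⟩

lemma perm_words {x : Fin n → A} (hx : IsSkewPBWExtension K x) {w w' : List (Fin n)}
    (h : w.Perm w') :
    ∃ c : K, (w.map x).prod - c • (w'.map x).prod ∈ wordsLT K x w.length := by
  induction h with
  | nil => exact ⟨1, by simp⟩
  | cons i h ih =>
    obtain ⟨c, hc⟩ := ih
    refine ⟨c, ?_⟩
    have := gen_mul_words i hc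
    simpa [mul_sub] using this
  | swap i j l =>
    obtain ⟨c, -, hc⟩ := hx.mul_gen i j
    refine ⟨c, ?_⟩
    have key : ∀ b ∈ Submodule.span K (insert (1 : A) (Set.range x)),
        b * (l.map x).prod ∈ wordsLT K x (l.length + 2) := by
      intro b hb
      induction hb using Submodule.span_induction with
      | mem b h =>
        rcases h with rfl | ⟨k, rfl⟩
        · rw [one_mul]; exact word_mem l (by omega)
        · exact gen_mul_words k (word_mem l (by omega))
      | zero => simp
      | add a b _ _ ha hb => rw [add_mul]; exact add_mem ha hb
      | smul c a _ ha => rw [smul_mul_assoc]; exact Submodule.smul_mem _ _ ha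
    have := key _ hc
    simpa [sub_mul, mul_assoc] using this
  | trans h₁ h₂ ih₁ ih₂ =>
    obtain ⟨c, hc⟩ := ih₁
    obtain ⟨e, he⟩ := ih₂
    refine ⟨c * e, ?_⟩
    rw [← h₁.length_eq] at he
    have := add_mem hc (Submodule.smul_mem _ c he)
    simpa [smul_sub, smul_smul] using this

/-- The non-decreasing word with `α i` letters `i`. -/
def stdWord (α : Fin n → ℕ) : List (Fin n) :=
  (List.ofFn fun i => List.replicate (α i) i).flatten

lemma stdWord_prod (x : Fin n → A) (α : Fin n → ℕ) :
    ((stdWord α).map x).prod = stdMonomial x α := by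
  simp [stdWord, stdMonomial, List.map_flatten, List.prod_flatten, List.map_ofFn,
    Function.comp_def]

lemma stdWord_length (α : Fin n → ℕ) : (stdWord α).length = ∑ i, α i := by
  simp [stdWord, List.length_flatten, List.map_ofFn, Function.comp_def, List.sum_ofFn]

lemma stdWord_perm (w : List (Fin n)) : w.Perm (stdWord fun i => w.count i) := by
  rw [List.perm_iff_count]
  intro a
  simp [stdWord, List.count_flatten, List.map_ofFn, Function.comp_def, List.sum_ofFn,
    List.count_replicate]

lemma word_mem_degreeFiltration {x : Fin n → A} (hx : IsSkewPBWExtension K x) (m : ℕ) :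
    ∀ w : List (Fin n), w.length = m → (w.map x).prod ∈ degreeFiltration K x m := by
  induction m using Nat.strong_induction_on with
  | _ m ih =>
    intro w hw
    obtain ⟨c, hc⟩ := perm_words hx (stdWord_perm w)
    rw [stdWord_prod] at hc
    have h1 : wordsLT K x w.length ≤ degreeFiltration K x m := by
      refine Submodule.span_le.2 ?_
      rintro _ ⟨v, hv, rfl⟩
      exact degreeFiltration_mono x (by omega) (ih v.length (by omega) v rfl)
    have h2 : stdMonomial x (fun i => w.count i) ∈ degreeFiltration K x m := by
      refine Submodule.subset_span ⟨_, ?_, rfl⟩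
      have := stdWord_length (fun i => w.count i)
      rw [← (stdWord_perm w).length_eq] at this
      exact le_of_eq (this.symm.trans hw)
    have := add_mem (h1 hc) (Submodule.smul_mem _ c h2)
    simpa using this

/-- The degree filtration makes a skew PBW extension of `K` a filtered ring. -/
lemma IsSkewPBWExtension.isRingFiltration {x : Fin n → A} (hx : IsSkewPBWExtension K x) :
    IsRingFiltration (degreeFiltration K x) (prevStep (degreeFiltration K x)) := by
  refine isRingFiltration_of _ (degreeFiltration_mono x) ?_ ?_
  · refine Submodule.subset_span ⟨0, by simp, ?_⟩
    simp [stdMonomial]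
  · intro i j a b ha hb
    induction ha using Submodule.span_induction with
    | mem a h =>
      obtain ⟨α, hα, rfl⟩ := h
      induction hb using Submodule.span_induction with
      | mem b h =>
        obtain ⟨β, hβ, rfl⟩ := h
        rw [← stdWord_prod x α, ← stdWord_prod x β, ← List.prod_append, ← List.map_append]
        refine degreeFiltration_mono x ?_ (word_mem_degreeFiltration hx _ _ rfl)
        rw [List.length_append, stdWord_length, stdWord_length]
        exact add_le_add hα hβ
      | zero => simp
      | add a b _ _ ha hb => rw [mul_add]; exact add_mem ha hb
      | smul c a _ ha => rw [mul_smul_comm]; exact Submodule.smul_mem _ _ ha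
    | zero => simp
    | add a b _ _ ha hb => rw [add_mul]; exact add_mem ha hb
    | smul c a _ ha => rw [smul_mul_assoc]; exact Submodule.smul_mem _ _ ha

end DegreeFiltration

/-! ## Homogeneous Koszul algebras -/

section Koszul

variable (K : Type*) {B : Type*} [Field K] [Ring B] [Algebra K B]

/-- The component `L_j` of the free algebra `L = K⟨x₁, …, xₙ⟩`, spanned by the words of length
`j`. -/
def freeAlgebraPart (n j : ℕ) : Submodule K (FreeAlgebra K (Fin n)) :=
  Submodule.span K {a | ∃ w : List (Fin n), w.length = j ∧ (w.map (FreeAlgebra.ι K)).prod = a}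

variable {K} in
/-- `B` with the grading `𝒜` is homogeneous pre-Koszul: it is, as a graded algebra, a quotient
`K⟨x₁, …, xₙ⟩ / I` with `I` a two-sided ideal generated by homogeneous quadratic elements
`∑ c_{jk} xⱼ xₖ`. (The last clause says that `𝒜` is the grading induced by word length.) -/
def IsHomogeneousPreKoszul (𝒜 : ℕ → Submodule K B) : Prop :=
  ∃ (n : ℕ) (S : Set (FreeAlgebra K (Fin n))) (π : FreeAlgebra K (Fin n) →ₐ[K] B),
    S ⊆ freeAlgebraPart K n 2 ∧
    Function.Surjective π ∧
    TwoSidedIdeal.ker π = TwoSidedIdeal.span S ∧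
    ∀ j, 𝒜 j = (freeAlgebraPart K n j).map π.toLinearMap

variable {K} in
/-- The degree `j` part of the graded free left module `B(-i)^(ι)`, that is, of the free module
`ι →₀ B` whose basis elements are all given degree `i`: the coefficients lie in `𝒜 (j - i)`, and
there is nothing but `0` in degrees `j < i`. -/
def shiftedFreePart (𝒜 : ℕ → Submodule K B) (ι : Type*) (i j : ℕ) : Set (ι →₀ B) :=
  {f | ∀ s, (i ≤ j ∧ f s ∈ 𝒜 (j - i)) ∨ f s = 0}

variable {K} in
/-- The trivial graded left module `K` has a linear free resolution
`⋯ → P₂ → P₁ → P₀ → K → 0`: an exact sequence of graded left `B`-modules and degree-preserving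
maps with `P_i = B(-i)^(ι i)` graded free, generated in degree `i`. The algebra `B` acts on `K`
through the augmentation `aug : B → K` that kills the components of positive degree, so a
`B`-linear map to `K` is an `aug`-semilinear map to `K`; the module `K` is concentrated in
degree `0`. -/
def HasLinearFreeResolution (𝒜 : ℕ → Submodule K B) : Prop :=
  ∃ (aug : B →ₐ[K] K) (ι : ℕ → Type)
    (d : ∀ i, (ι (i + 1) →₀ B) →ₗ[B] (ι i →₀ B))
    (ε : (ι 0 →₀ B) →ₛₗ[(aug : B →+* K)] K),
    (∀ j, 0 < j → ∀ b ∈ 𝒜 j, aug b = 0) ∧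
    (∀ i j, ∀ f ∈ shiftedFreePart 𝒜 (ι (i + 1)) (i + 1) j, d i f ∈ shiftedFreePart 𝒜 (ι i) i j) ∧
    (∀ j, 0 < j → ∀ f ∈ shiftedFreePart 𝒜 (ι 0) 0 j, ε f = 0) ∧
    Function.Surjective ε ∧
    Function.Exact (d 0) ε ∧
    ∀ i, Function.Exact (d (i + 1)) (d i)

variable {K} in
/-- `B` with the grading `𝒜` is a homogeneous Koszul algebra: it is homogeneous pre-Koszul and the
trivial module `K` has a linear free resolution. -/
def IsHomogeneousKoszul (𝒜 : ℕ → Submodule K B) : Prop :=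
  IsHomogeneousPreKoszul 𝒜 ∧ HasLinearFreeResolution 𝒜

end Koszul

end SkewPBW

/-! The ring $\mathrm{Gr}(A)$ is a quantum affine space. In $x_jx_i - c\,x_ix_j$ everything left
over has degree at most 1, so it vanishes in $F_2/F_1$; hence the classes $y_i$ of the generators
commute up to nonzero scalars, and their standard monomials still form a basis, since the
coefficient of $x^\alpha$ descends to $F_{|\alpha|}/F_{|\alpha|-1}$ (`linearIndependent_grGen`,
`span_stdMonomial_grGen`).

Now let $B$ be any algebra with $y_iy_j = q_{ij}y_jy_i$, all $q_{ij}\neq 0$, and a basis of standard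
monomials. The commutation relations reduce each word to a multiple of a standard monomial, and
these stay independent in $B$, so there are no further relations: $B$ is quadratic
(`isHomogeneousPreKoszul_of_basis`). The resolution is the $q$-deformed Koszul complex $\bigoplus_S
B e_S$, with $S$ running over the subsets of the generators and $e_S$ in degree $|S|$. It is exact
because of an explicit homotopy that strips the last letter of a monomial and adjoins it to $S$ when
it exceeds all of $S$ (`koszulD_koszulH_add`, `koszulD_koszulH_empty`). -/

namespace SkewPBW

/-! ### Reordering words in generators that commute up to scalars. -/

section Words

variable {K B : Type*} [Field K] [Ring B] [Algebra K B] {n : ℕ}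

lemma smul_mem_twoSidedIdeal (J : TwoSidedIdeal B) (c : K) {a : B} (ha : a ∈ J) : c • a ∈ J := by
  rw [Algebra.smul_def]; exact J.mul_mem_left _ _ ha

/-- If the generators commute up to scalars modulo `J`, words with the same letters agree up to a
scalar modulo `J`. -/
lemma word_perm_mod {y : Fin n → B} {q : Fin n → Fin n → K} (J : TwoSidedIdeal B)
    (hy : ∀ i j, y i * y j - q i j • (y j * y i) ∈ J) {w w' : List (Fin n)} (h : w.Perm w') :
    ∃ c : K, (w.map y).prod - c • (w'.map y).prod ∈ J := by
  induction h with
  | nil => exact ⟨1, by simp [J.zero_mem]⟩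
  | cons i h ih =>
    obtain ⟨c, hc⟩ := ih
    refine ⟨c, ?_⟩
    simpa [mul_sub] using J.mul_mem_left (y i) _ hc
  | swap i j l =>
    refine ⟨q j i, ?_⟩
    simpa [sub_mul, mul_assoc] using J.mul_mem_right _ (l.map y).prod (hy j i)
  | trans h₁ h₂ ih₁ ih₂ =>
    obtain ⟨c, hc⟩ := ih₁
    obtain ⟨e, he⟩ := ih₂
    refine ⟨c * e, ?_⟩
    simpa [smul_sub, smul_smul] using J.add_mem hc (smul_mem_twoSidedIdeal J c he)

lemma word_eq_smul_stdMonomial {y : Fin n → B} {q : Fin n → Fin n → K}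
    (hy : ∀ i j, y i * y j = q i j • (y j * y i)) (w : List (Fin n)) :
    ∃ c : K, (w.map y).prod = c • stdMonomial y (fun i => w.count i) := by
  -- With the zero ideal, congruence is equality in `B`; the free algebra uses the same lemma with
  -- the ideal of relations.
  obtain ⟨c, hc⟩ := word_perm_mod (y := y) (q := q) ⊥ (fun i j => by simp [← hy])
    (stdWord_perm w)
  rw [stdWord_prod] at hc
  exact ⟨c, sub_eq_zero.1 (by simpa using hc)⟩

lemma count_stdWord (α : Fin n → ℕ) (i : Fin n) : (stdWord α).count i = α i := by
  simp [stdWord, List.count_flatten, List.map_ofFn, Function.comp_def, List.sum_ofFn,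
    List.count_replicate]

lemma stdMonomial_mul_stdMonomial {y : Fin n → B} {q : Fin n → Fin n → K}
    (hy : ∀ i j, y i * y j = q i j • (y j * y i)) (α β : Fin n → ℕ) :
    ∃ c : K, stdMonomial y α * stdMonomial y β = c • stdMonomial y (α + β) := by
  obtain ⟨c, hc⟩ := word_eq_smul_stdMonomial hy (stdWord α ++ stdWord β)
  refine ⟨c, ?_⟩
  rw [← stdWord_prod y α, ← stdWord_prod y β, ← List.prod_append, ← List.map_append, hc]
  congr 2
  ext i
  simp [count_stdWord]

@[simp] lemma stdMonomial_zero (y : Fin n → B) : stdMonomial y 0 = 1 := by simp [stdMonomial]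

lemma mem_stdWord {α : Fin n → ℕ} {i : Fin n} : i ∈ stdWord α ↔ α i ≠ 0 := by
  rw [← List.count_pos_iff, count_stdWord, Nat.pos_iff_ne_zero]

lemma stdWord_pairwise (α : Fin n → ℕ) : (stdWord α).Pairwise (· ≤ ·) := by
  rw [stdWord, List.pairwise_flatten]
  constructor
  · intro l hl
    obtain ⟨i, rfl⟩ := (List.mem_ofFn' _ _).1 hl
    simp [List.pairwise_replicate]
  · rw [List.pairwise_ofFn]
    intro i j hij a ha b hb
    rw [(List.mem_replicate.1 ha).2, (List.mem_replicate.1 hb).2]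
    exact hij.le

/-- Appending a letter at least as large as all the others keeps the word sorted, so no reordering
and hence no scalar occurs. -/
lemma stdMonomial_mul_gen_of_le (y : Fin n → B) {α : Fin n → ℕ} {m : Fin n}
    (h : ∀ t, m < t → α t = 0) :
    stdMonomial y α * y m = stdMonomial y (α + Pi.single m 1) := by
  have : stdWord α ++ [m] = stdWord (α + Pi.single m 1) := by
    refine List.Perm.eq_of_pairwise' ?_ (stdWord_pairwise _) ?_
    · rw [List.pairwise_append]
      refine ⟨stdWord_pairwise α, by simp, fun a ha b hb => ?_⟩
      rw [List.mem_singleton.1 hb]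
      by_contra hlt
      exact mem_stdWord.1 ha (h a (not_le.1 hlt))
    · rw [List.perm_iff_count]
      intro a
      rcases eq_or_ne a m with rfl | ham
      · simp [count_stdWord]
      · simp [count_stdWord, ham, ham.symm]
  rw [← stdWord_prod, ← stdWord_prod, ← this]
  simp

lemma stdMonomial_single (y : Fin n → B) (m : Fin n) : stdMonomial y (Pi.single m 1) = y m := by
  have := stdMonomial_mul_gen_of_le y (α := 0) (m := m) (fun _ _ => rfl)
  simpa using this.symm

lemma stdMonomial_mul_gen {y : Fin n → B} {q : Fin n → Fin n → K}
    (hy : ∀ i j, y i * y j = q i j • (y j * y i)) (α : Fin n → ℕ) (s : Fin n) :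
    ∃ c : K, stdMonomial y α * y s = c • stdMonomial y (α + Pi.single s 1) := by
  simpa only [stdMonomial_single] using stdMonomial_mul_stdMonomial hy α (Pi.single s 1)

end Words

/-! ### Quadratic presentation. -/

section PreKoszul

variable {K B : Type*} [Field K] [Ring B] [Algebra K B] {n : ℕ}

lemma span_words_freeAlgebra :
    Submodule.span K {a | ∃ w : List (Fin n), (w.map (FreeAlgebra.ι K)).prod = a} =
      (⊤ : Submodule K (FreeAlgebra K (Fin n))) := by
  rw [← Algebra.top_toSubmodule, ← FreeAlgebra.adjoin_range_ι, Algebra.adjoin_eq_span]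
  congr 1
  ext a
  constructor
  · rintro ⟨w, rfl⟩
    exact Submonoid.list_prod_mem _ fun b hb => by
      obtain ⟨i, -, rfl⟩ := List.mem_map.1 hb
      exact Submonoid.subset_closure ⟨i, rfl⟩
  · intro ha
    induction ha using Submonoid.closure_induction with
    | mem a h => obtain ⟨i, rfl⟩ := h; exact ⟨[i], by simp⟩
    | one => exact ⟨[], by simp⟩
    | mul a b _ _ ha hb =>
      obtain ⟨v, rfl⟩ := ha
      obtain ⟨w, rfl⟩ := hb
      exact ⟨v ++ w, by simp⟩

/-- Modulo the commutation relations, every element of the free algebra is a combination of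
standard monomials. -/
lemma exists_stdMonomial_comb (J : TwoSidedIdeal (FreeAlgebra K (Fin n))) (q : Fin n → Fin n → K)
    (hJ : ∀ i j, FreeAlgebra.ι K i * FreeAlgebra.ι K j -
      q i j • (FreeAlgebra.ι K j * FreeAlgebra.ι K i) ∈ J) (a : FreeAlgebra K (Fin n)) :
    ∃ g : (Fin n → ℕ) →₀ K,
      a - Finsupp.linearCombination K (stdMonomial (FreeAlgebra.ι K)) g ∈ J := by
  have ha : a ∈ Submodule.span K {a | ∃ w : List (Fin n), (w.map (FreeAlgebra.ι K)).prod = a} := by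
    rw [span_words_freeAlgebra]; trivial
  induction ha using Submodule.span_induction with
  | mem a h =>
    obtain ⟨w, rfl⟩ := h
    obtain ⟨c, hc⟩ := word_perm_mod J hJ (stdWord_perm w)
    refine ⟨Finsupp.single (fun i => w.count i) c, ?_⟩
    rwa [Finsupp.linearCombination_single, ← stdWord_prod]
  | zero => exact ⟨0, by simp [J.zero_mem]⟩
  | add a b _ _ ha hb =>
    obtain ⟨g, hg⟩ := ha
    obtain ⟨g', hg'⟩ := hb
    refine ⟨g + g', ?_⟩
    rw [map_add, add_sub_add_comm]
    exact J.add_mem hg hg'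
  | smul c a _ ha =>
    obtain ⟨g, hg⟩ := ha
    refine ⟨c • g, ?_⟩
    rw [map_smul, ← smul_sub]
    exact smul_mem_twoSidedIdeal J c hg

/-- The relations span the whole kernel by a size argument: modulo them the free algebra is spanned
by standard monomials, whose images in `B` are already independent. -/
theorem isHomogeneousPreKoszul_of_basis {y : Fin n → B} (b : Module.Basis (Fin n → ℕ) K B)
    (hb : ∀ α, b α = stdMonomial y α) {q : Fin n → Fin n → K}
    (hy : ∀ i j, y i * y j = q i j • (y j * y i)) {𝒜 : ℕ → Submodule K B}
    (h𝒜 : ∀ j, 𝒜 j = Submodule.span K {a | ∃ w : List (Fin n), w.length = j ∧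
      (w.map y).prod = a}) :
    IsHomogeneousPreKoszul 𝒜 := by
  have hword : ∀ w : List (Fin n),
      FreeAlgebra.lift K y (w.map (FreeAlgebra.ι K)).prod = (w.map y).prod := by
    intro w
    rw [map_list_prod, List.map_map]
    congr 2
    ext i
    simp
  have hstd : ∀ α, FreeAlgebra.lift K y (stdMonomial (FreeAlgebra.ι K) α) = b α := by
    intro α
    rw [← stdWord_prod, hword, stdWord_prod, hb]
  refine ⟨n, {a | ∃ i j, a = FreeAlgebra.ι K i * FreeAlgebra.ι K j -
      q i j • (FreeAlgebra.ι K j * FreeAlgebra.ι K i)}, FreeAlgebra.lift K y, ?_, ?_, ?_, ?_⟩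
  · rintro _ ⟨i, j, rfl⟩
    refine sub_mem (Submodule.subset_span ⟨[i, j], rfl, by simp⟩)
      (Submodule.smul_mem _ _ (Submodule.subset_span ⟨[j, i], rfl, by simp⟩))
  · have : (⊤ : Submodule K B) ≤ LinearMap.range (FreeAlgebra.lift K y).toLinearMap := by
      rw [← b.span_eq, Submodule.span_le]
      rintro _ ⟨α, rfl⟩
      exact ⟨_, hstd α⟩
    intro a
    exact this (Submodule.mem_top : a ∈ ⊤)
  · apply le_antisymm
    · intro a ha
      rw [TwoSidedIdeal.mem_ker] at ha
      obtain ⟨g, hg⟩ := exists_stdMonomial_comb (TwoSidedIdeal.span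
        {a | ∃ i j, a = FreeAlgebra.ι K i * FreeAlgebra.ι K j -
          q i j • (FreeAlgebra.ι K j * FreeAlgebra.ι K i)}) q
        (fun i j => TwoSidedIdeal.subset_span ⟨i, j, rfl⟩) a
      have hle : TwoSidedIdeal.span {a | ∃ i j, a = FreeAlgebra.ι K i * FreeAlgebra.ι K j -
          q i j • (FreeAlgebra.ι K j * FreeAlgebra.ι K i)} ≤
          TwoSidedIdeal.ker (FreeAlgebra.lift K y) := by
        rw [TwoSidedIdeal.span_le]
        rintro _ ⟨i, j, rfl⟩
        simp [TwoSidedIdeal.mem_ker, ← hy]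
      -- The normal form of `a` maps to zero as `a` does; being a combination of basis vectors
      -- there, it has zero coefficients, so `a` itself lies in the ideal.
      have h0 := (TwoSidedIdeal.mem_ker _).1 (hle hg)
      rw [map_sub, ha, zero_sub, neg_eq_zero, Finsupp.linearCombination_apply, map_finsuppSum] at h0
      simp only [map_smul, hstd] at h0
      have := b.linearIndependent
      rw [linearIndependent_iff] at this
      have hg0 := this g h0
      simpa [hg0] using hg
    · rw [TwoSidedIdeal.span_le]
      rintro _ ⟨i, j, rfl⟩
      simp [TwoSidedIdeal.mem_ker, ← hy]
  · intro j
    rw [h𝒜, freeAlgebraPart, Submodule.map_span]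
    congr 1
    ext a
    constructor
    · rintro ⟨w, hw, rfl⟩
      exact ⟨_, ⟨w, hw, rfl⟩, hword w⟩
    · rintro ⟨_, ⟨w, hw, rfl⟩, rfl⟩
      exact ⟨w, hw, (hword w).symm⟩

end PreKoszul

end SkewPBW

namespace SkewPBW

/-! ### Division by the last letter of a monomial, and the augmentation. -/

section Division

variable {K B : Type*} [Field K] [Ring B] [Algebra K B] {n : ℕ}

open Classical in
/-- Right division by `y m` of the standard monomials whose last letter is `y m`; the other
standard monomials go to `0`. -/
noncomputable def divLast (b : Module.Basis (Fin n → ℕ) K B) (m : Fin n) : B →ₗ[K] B :=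
  b.constr K fun α =>
    if α m ≠ 0 ∧ ∀ t, m < t → α t = 0 then b (α - Pi.single m 1) else 0

variable {y : Fin n → B} {b : Module.Basis (Fin n → ℕ) K B} {q : Fin n → Fin n → K}

lemma divLast_of_not {m : Fin n} {α : Fin n → ℕ} (h : ¬ (α m ≠ 0 ∧ ∀ t, m < t → α t = 0)) :
    divLast b m (b α) = 0 := by
  rw [divLast, Module.Basis.constr_basis, if_neg h]

lemma divLast_add_single {m : Fin n} {α : Fin n → ℕ} (h : ∀ t, m < t → α t = 0) :
    divLast b m (b (α + Pi.single m 1)) = b α := by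
  rw [divLast, Module.Basis.constr_basis, if_pos, add_tsub_cancel_right]
  refine ⟨by simp, fun t ht => ?_⟩
  simp [h t ht, ht.ne']

lemma basis_mul_gen (hb : ∀ α, b α = stdMonomial y α)
    (hy : ∀ i j, y i * y j = q i j • (y j * y i)) (α : Fin n → ℕ) (s : Fin n) :
    ∃ c : K, b α * y s = c • b (α + Pi.single s 1) := by
  simpa only [hb] using stdMonomial_mul_gen hy α s

lemma basis_mul_gen_of_le (hb : ∀ α, b α = stdMonomial y α) {α : Fin n → ℕ} {m : Fin n}
    (h : ∀ t, m < t → α t = 0) : b α * y m = b (α + Pi.single m 1) := by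
  simpa only [hb] using stdMonomial_mul_gen_of_le y h

lemma exists_eq_add_single {α : Fin n → ℕ} {m : Fin n}
    (h : α m ≠ 0 ∧ ∀ t, m < t → α t = 0) :
    ∃ β : Fin n → ℕ, (∀ t, m < t → β t = 0) ∧ α = β + Pi.single m 1 := by
  refine ⟨α - Pi.single m 1, fun t ht => by simp [h.2 t ht], ?_⟩
  refine (tsub_add_cancel_of_le fun t => ?_).symm
  rcases eq_or_ne t m with rfl | ht
  · simpa using Nat.one_le_iff_ne_zero.2 h.1
  · simp [ht]

/-- Every monomial of `z * y s` contains the letter `s`, so its last letter is beyond `m`. -/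
lemma divLast_mul_of_lt (hb : ∀ α, b α = stdMonomial y α)
    (hy : ∀ i j, y i * y j = q i j • (y j * y i)) {m s : Fin n} (hs : m < s) (z : B) :
    divLast b m (z * y s) = 0 := by
  suffices divLast b m ∘ₗ LinearMap.mulRight K (y s) = 0 from LinearMap.congr_fun this z
  refine b.ext fun α => ?_
  obtain ⟨c, hc⟩ := basis_mul_gen hb hy α s
  simp only [LinearMap.comp_apply, LinearMap.mulRight_apply, LinearMap.zero_apply, hc, map_smul]
  rw [divLast_of_not, smul_zero]
  intro h
  simpa using h.2 s hs

/-- A smaller letter multiplied on the right must cross the final `y m`, which costs `q m s`; it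
does not change whether `m` is the last letter. -/
lemma divLast_mul_of_gt (hb : ∀ α, b α = stdMonomial y α)
    (hy : ∀ i j, y i * y j = q i j • (y j * y i)) {m s : Fin n} (hs : s < m) (z : B) :
    divLast b m (z * y s) = q m s • (divLast b m z * y s) := by
  suffices divLast b m ∘ₗ LinearMap.mulRight K (y s) =
      q m s • (LinearMap.mulRight K (y s) ∘ₗ divLast b m) from LinearMap.congr_fun this z
  refine b.ext fun α => ?_
  simp only [LinearMap.comp_apply, LinearMap.mulRight_apply, LinearMap.smul_apply]
  by_cases h : α m ≠ 0 ∧ ∀ t, m < t → α t = 0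
  · obtain ⟨β, hβ, rfl⟩ := exists_eq_add_single h
    obtain ⟨c, hc⟩ := basis_mul_gen hb hy β s
    have hβ' : ∀ t, m < t → (β + Pi.single s 1 : Fin n → ℕ) t = 0 := fun t ht => by
      simp [hβ t ht, (hs.trans ht).ne']
    rw [divLast_add_single hβ, ← basis_mul_gen_of_le hb hβ, mul_assoc, hy m s, mul_smul_comm,
      ← mul_assoc, hc, smul_mul_assoc, basis_mul_gen_of_le hb hβ', map_smul, map_smul,
      divLast_add_single hβ']
  · obtain ⟨c, hc⟩ := basis_mul_gen hb hy α s
    rw [divLast_of_not h, hc, map_smul, divLast_of_not, smul_zero, zero_mul, smul_zero]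
    refine fun h' => h ⟨by simpa [hs.ne'] using h'.1, fun t ht => ?_⟩
    simpa [(hs.trans ht).ne'] using h'.2 t ht

/-- The last letter of a nontrivial standard monomial. -/
lemma exists_last {α : Fin n → ℕ} (h : α ≠ 0) : ∃ k, α k ≠ 0 ∧ ∀ t, k < t → α t = 0 := by
  have hne : (Finset.univ.filter fun i => α i ≠ 0).Nonempty := by
    obtain ⟨i, hi⟩ := Function.ne_iff.1 h
    exact ⟨i, by simpa using hi⟩
  refine ⟨_, (Finset.mem_filter.1 (Finset.max'_mem _ hne)).2, fun t ht => ?_⟩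
  by_contra h0
  exact ht.not_ge (Finset.le_max' _ t (by simpa using h0))

lemma divLast_mul_gen_basis (hb : ∀ α, b α = stdMonomial y α) {α : Fin n → ℕ} {k : Fin n}
    (hk : α k ≠ 0 ∧ ∀ t, k < t → α t = 0) (s : Fin n) :
    divLast b s (b α) * y s = if s = k then b α else 0 := by
  split_ifs with hs
  · subst hs
    obtain ⟨β, hβ, rfl⟩ := exists_eq_add_single hk
    rw [divLast_add_single hβ, basis_mul_gen_of_le hb hβ]
  · rw [divLast_of_not, zero_mul]
    rintro ⟨h1, h2⟩
    rcases lt_or_gt_of_ne hs with h | h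
    · exact hk.1 (h2 k h)
    · exact h1 (hk.2 s h)

/-- This splits `z` by last letter. A monomial with all letters at most `m` is recovered by
multiplying and then dividing by `y m`; one with last letter `k` beyond `m` is recovered by the
summand `s = k` alone. -/
lemma divLast_mul_self_add_sum (hb : ∀ α, b α = stdMonomial y α)
    (hy : ∀ i j, y i * y j = q i j • (y j * y i)) (m : Fin n) (z : B) :
    divLast b m (z * y m) + ∑ s ∈ Finset.Ioi m, divLast b s z * y s = z := by
  suffices divLast b m ∘ₗ LinearMap.mulRight K (y m) +
      ∑ s ∈ Finset.Ioi m, LinearMap.mulRight K (y s) ∘ₗ divLast b s = LinearMap.id by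
    simpa using LinearMap.congr_fun this z
  refine b.ext fun α => ?_
  simp only [LinearMap.add_apply, LinearMap.sum_apply, LinearMap.comp_apply,
    LinearMap.mulRight_apply, LinearMap.id_apply]
  by_cases h : ∀ t, m < t → α t = 0
  · rw [basis_mul_gen_of_le hb h, divLast_add_single h, Finset.sum_eq_zero, add_zero]
    intro s hs
    rw [divLast_of_not, zero_mul]
    exact fun h' => h'.1 (h s (Finset.mem_Ioi.1 hs))
  · have hα : α ≠ 0 := by rintro rfl; exact h fun _ _ => rfl
    obtain ⟨k, hk⟩ := exists_last hα
    have hmk : m < k := by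
      by_contra hle
      exact h fun t ht => hk.2 t ((not_lt.1 hle).trans_lt ht)
    obtain ⟨c, hc⟩ := basis_mul_gen hb hy α m
    rw [hc, map_smul, divLast_of_not, smul_zero, zero_add]
    · simp only [divLast_mul_gen_basis hb hk]
      rw [Finset.sum_ite_eq', if_pos (Finset.mem_Ioi.2 hmk)]
    · intro h'
      have := h'.2 k hmk
      simp [hk.1] at this

/-- The projection to `K` along the nontrivial standard monomials. -/
noncomputable def augOfBasis (hb : ∀ α, b α = stdMonomial y α)
    (hy : ∀ i j, y i * y j = q i j • (y j * y i)) : B →ₐ[K] K :=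
  AlgHom.ofLinearMap (b.coord 0)
    (by rw [← stdMonomial_zero y, ← hb, Module.Basis.coord_apply, b.repr_self,
      Finsupp.single_eq_same])
    (by
      rw [LinearMap.map_mul_iff]
      refine b.ext fun α => b.ext fun β => ?_
      simp only [LinearMap.compr₂_apply, LinearMap.mul_apply', LinearMap.compl₂_apply,
        LinearMap.comp_apply]
      -- For `α ≠ 0` both sides vanish, because the exponent `α + β` is nonzero as well.
      by_cases hα : α = 0
      · subst hα
        rw [hb 0, stdMonomial_zero, one_mul, ← stdMonomial_zero y, ← hb]
        simp
      · obtain ⟨c, hc⟩ := stdMonomial_mul_stdMonomial hy α β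
        have hαβ : α + β ≠ 0 := fun h => hα (by
          ext i
          have := congrFun h i
          simp at this ⊢
          exact this.1)
        simp only [← hb] at hc
        simp [hc, Finsupp.single_apply, hα, hαβ])

lemma augOfBasis_basis (hb : ∀ α, b α = stdMonomial y α)
    (hy : ∀ i j, y i * y j = q i j • (y j * y i)) {α : Fin n → ℕ} (hα : α ≠ 0) :
    augOfBasis hb hy (b α) = 0 := by
  simp [augOfBasis, hα]

/-- Each nontrivial monomial has exactly one last letter; only the constant term is lost. This is
the homotopy identity at the empty set. -/
lemma sum_divLast_mul (hb : ∀ α, b α = stdMonomial y α)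
    (hy : ∀ i j, y i * y j = q i j • (y j * y i)) (z : B) :
    ∑ s, divLast b s z * y s = z - algebraMap K B (augOfBasis hb hy z) := by
  suffices ∑ s, LinearMap.mulRight K (y s) ∘ₗ divLast b s =
      LinearMap.id - Algebra.linearMap K B ∘ₗ (augOfBasis hb hy).toLinearMap by
    simpa using LinearMap.congr_fun this z
  refine b.ext fun α => ?_
  simp only [LinearMap.sum_apply, LinearMap.comp_apply, LinearMap.mulRight_apply,
    LinearMap.sub_apply, LinearMap.id_apply, AlgHom.toLinearMap_apply, Algebra.linearMap_apply]
  by_cases hα : α = 0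
  · subst hα
    rw [Finset.sum_eq_zero, hb, stdMonomial_zero, map_one, map_one, sub_self]
    intro s _
    rw [divLast_of_not (by simp), zero_mul]
  · obtain ⟨k, hk⟩ := exists_last hα
    simp only [divLast_mul_gen_basis hb hk, augOfBasis_basis hb hy hα]
    simp

end Division

end SkewPBW

namespace SkewPBW

/-! ### The quantum Koszul complex and its contracting homotopy. -/

section Complex

variable {K B : Type*} [Field K] [Ring B] [Algebra K B] {n : ℕ}

/-- The coefficient of `e_{S ∖ s}` in the differential of `e_S`. -/
def koszulCoeff (q : Fin n → Fin n → K) (s : Fin n) (S : Finset (Fin n)) : K :=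
  ∏ t ∈ S with t < s, -(q s t)⁻¹

section Coeff

variable {q : Fin n → Fin n → K} {s t : Fin n} {S : Finset (Fin n)}

lemma koszulCoeff_ne_zero (hq : ∀ i j, q i j ≠ 0) : koszulCoeff q s S ≠ 0 :=
  Finset.prod_ne_zero_iff.2 fun _ _ => neg_ne_zero.2 (inv_ne_zero (hq _ _))

lemma koszulCoeff_insert_of_le (h : s ≤ t) :
    koszulCoeff q s (insert t S) = koszulCoeff q s S := by
  rw [koszulCoeff, Finset.filter_insert, if_neg h.not_gt, koszulCoeff]

lemma koszulCoeff_insert_of_lt (h : t < s) (ht : t ∉ S) :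
    koszulCoeff q s (insert t S) = -(q s t)⁻¹ * koszulCoeff q s S := by
  rw [koszulCoeff, Finset.filter_insert, if_pos h, Finset.prod_insert (by simp [ht]), koszulCoeff]

lemma koszulCoeff_erase_of_le (h : s ≤ t) :
    koszulCoeff q s (S.erase t) = koszulCoeff q s S := by
  by_cases ht : t ∈ S
  · rw [← koszulCoeff_insert_of_le h, Finset.insert_erase ht]
  · rw [Finset.erase_eq_of_notMem ht]

end Coeff

/-- The differential of the Koszul complex of a quantum affine space, on the direct sum
`⨁_S B e_S`: it sends `e_S` to `∑_{s ∈ S} koszulCoeff q s S • y s e_{S ∖ s}`. -/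
def koszulD (y : Fin n → B) (q : Fin n → Fin n → K) :
    (Finset (Fin n) → B) →ₗ[B] (Finset (Fin n) → B) where
  toFun f S := ∑ s ∈ Sᶜ, koszulCoeff q s S • (f (insert s S) * y s)
  map_add' f g := by
    ext S
    simp [add_mul, Finset.sum_add_distrib]
  map_smul' c f := by
    ext S
    simp [Finset.mul_sum, mul_assoc]

lemma koszulD_apply (y : Fin n → B) (q : Fin n → Fin n → K) (f : Finset (Fin n) → B)
    (S : Finset (Fin n)) :
    koszulD y q f S = ∑ s ∈ Sᶜ, koszulCoeff q s S • (f (insert s S) * y s) := rfl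

variable {y : Fin n → B} {q : Fin n → Fin n → K}

/-- The two orders of removing `s` and `t` cancel: the factor `-(q s t)⁻¹` in `koszulCoeff`
compensates exactly for exchanging `y s` and `y t`. -/
lemma koszulD_term_add_swap (hq : ∀ i j, q i j ≠ 0)
    (hy : ∀ i j, y i * y j = q i j • (y j * y i)) {s t : Fin n} {S : Finset (Fin n)}
    (ht : t ∉ S) (hts : t < s) (a : B) :
    koszulCoeff q s S • (koszulCoeff q t (insert s S) • (a * y t) * y s) +
      koszulCoeff q t S • (koszulCoeff q s (insert t S) • (a * y s) * y t) = 0 := by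
  rw [koszulCoeff_insert_of_le hts.le, koszulCoeff_insert_of_lt hts ht]
  simp only [smul_mul_assoc, mul_assoc, smul_smul]
  rw [hy s t, mul_smul_comm, smul_smul, ← add_smul]
  have := hq s t
  rw [show koszulCoeff q s S * koszulCoeff q t S +
    koszulCoeff q t S * (-(q s t)⁻¹ * koszulCoeff q s S) * q s t = 0 by field_simp; ring,
    zero_smul]

lemma koszulD_koszulD (hq : ∀ i j, q i j ≠ 0) (hy : ∀ i j, y i * y j = q i j • (y j * y i))
    (f : Finset (Fin n) → B) : koszulD y q (koszulD y q f) = 0 := by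
  ext S
  simp only [koszulD_apply, Finset.sum_mul, Finset.smul_sum, Pi.zero_apply]
  rw [Finset.sum_sigma']
  -- The terms of the double sum are paired by swapping the two removed indices.
  refine Finset.sum_involution (fun p _ => ⟨p.2, p.1⟩) ?_ ?_ ?_ ?_
  · rintro ⟨s, t⟩ h
    simp only [Finset.mem_sigma, Finset.mem_compl, Finset.mem_insert, not_or] at h
    obtain ⟨hs, hts, ht⟩ := h
    simp only [Finset.insert_comm s t]
    rcases lt_or_gt_of_ne hts with hlt | hlt
    · exact koszulD_term_add_swap hq hy ht hlt _
    · rw [add_comm]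
      exact koszulD_term_add_swap hq hy hs hlt _
  · rintro ⟨s, t⟩ h - heq
    simp only [Finset.mem_sigma, Finset.mem_compl, Finset.mem_insert, not_or] at h
    exact h.2.1 (congrArg Sigma.fst heq)
  · rintro ⟨s, t⟩ h
    simp only [Finset.mem_sigma, Finset.mem_compl, Finset.mem_insert, not_or] at h ⊢
    exact ⟨h.2.2, fun e => h.2.1 e.symm, h.1⟩
  · rintro ⟨s, t⟩ _
    rfl

variable {b : Module.Basis (Fin n → ℕ) K B}

/-- The contracting homotopy of the Koszul complex: it moves the last letter of a monomial into
the exterior part, provided that it is larger than all letters there. -/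
noncomputable def koszulH (b : Module.Basis (Fin n → ℕ) K B) (q : Fin n → Fin n → K)
    (f : Finset (Fin n) → B) (S : Finset (Fin n)) : B :=
  if h : S.Nonempty then
    (koszulCoeff q (S.max' h) S)⁻¹ • divLast b (S.max' h) (f (S.erase (S.max' h)))
  else 0

lemma koszulH_of_max (f : Finset (Fin n) → B) {S : Finset (Fin n)} {m : Fin n} (hm : m ∈ S)
    (hmax : ∀ t ∈ S, t ≤ m) :
    koszulH b q f S = (koszulCoeff q m S)⁻¹ • divLast b m (f (S.erase m)) := by
  have h : S.Nonempty := ⟨m, hm⟩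
  have : S.max' h = m := le_antisymm (hmax _ (S.max'_mem h)) (S.le_max' _ hm)
  rw [koszulH, dif_pos h, this]

lemma koszulH_insert_of_lt (hq : ∀ i j, q i j ≠ 0) (f : Finset (Fin n) → B) {S : Finset (Fin n)}
    {s : Fin n} (h : ∀ t ∈ S, t < s) :
    koszulCoeff q s S • (koszulH b q f (insert s S) * y s) = divLast b s (f S) * y s := by
  have hs : s ∉ S := fun hs => (h s hs).false
  rw [koszulH_of_max f (Finset.mem_insert_self s S), Finset.erase_insert hs,
    koszulCoeff_insert_of_le le_rfl, smul_mul_assoc, smul_smul,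
    mul_inv_cancel₀ (koszulCoeff_ne_zero hq), one_smul]
  intro t ht
  rcases Finset.mem_insert.1 ht with rfl | ht
  · exact le_rfl
  · exact (h t ht).le

lemma koszulD_koszulH_empty (hq : ∀ i j, q i j ≠ 0)
    (hb : ∀ α, b α = stdMonomial y α)
    (hy : ∀ i j, y i * y j = q i j • (y j * y i)) (f : Finset (Fin n) → B) :
    koszulD y q (koszulH b q f) ∅ = f ∅ - algebraMap K B (augOfBasis hb hy (f ∅)) := by
  rw [← sum_divLast_mul hb hy, koszulD_apply, Finset.compl_empty]
  exact Finset.sum_congr rfl fun s _ => koszulH_insert_of_lt hq f (by simp)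

/-- With `m` the maximum of `S`, the index `s = m` in the second term gives `divLast b m (f S * y
m)`. Indices `s < m` outside `S` cancel between the two terms, and indices `s > m` give `divLast b s
(f S) * y s`. The total is `f S` by `divLast_mul_self_add_sum`. -/
lemma koszulD_koszulH_add (hq : ∀ i j, q i j ≠ 0) (hb : ∀ α, b α = stdMonomial y α)
    (hy : ∀ i j, y i * y j = q i j • (y j * y i)) (f : Finset (Fin n) → B)
    {S : Finset (Fin n)} (hS : S.Nonempty) :
    koszulD y q (koszulH b q f) S + koszulH b q (koszulD y q f) S = f S := by
  obtain ⟨m, hm, hmax⟩ : ∃ m ∈ S, ∀ t ∈ S, t ≤ m := ⟨S.max' hS, S.max'_mem hS, S.le_max'⟩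
  have hmc : m ∉ Sᶜ := by simpa using hm
  have hcompl : (S.erase m)ᶜ = insert m Sᶜ := Finset.compl_erase
  have hE : koszulCoeff q m S ≠ 0 := koszulCoeff_ne_zero hq
  rw [koszulH_of_max _ hm hmax, koszulD_apply, koszulD_apply, hcompl, Finset.sum_insert hmc,
    Finset.insert_erase hm, koszulCoeff_erase_of_le le_rfl, map_add, smul_add, map_smul,
    smul_smul, inv_mul_cancel₀ hE, one_smul, map_sum, Finset.smul_sum, add_left_comm,
    ← Finset.sum_add_distrib]
  conv_rhs => rw [← divLast_mul_self_add_sum hb hy m (f S)]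
  congr 1
  have hsub : Finset.Ioi m ⊆ Sᶜ := fun s hs =>
    Finset.mem_compl.2 fun h => (Finset.mem_Ioi.1 hs).not_ge (hmax s h)
  symm
  refine Finset.sum_subset_zero_on_sdiff hsub ?_ ?_
  -- Here `s < m` lies outside `S`: `m` remains the maximum of `insert s S`, and the scalar `q m s`
  -- from crossing `y m` cancels the two contributions.
  · intro s hs
    simp only [Finset.mem_sdiff, Finset.mem_compl, Finset.mem_Ioi, not_lt] at hs
    have hsm : s < m := lt_of_le_of_ne hs.2 fun e => hs.1 (e ▸ hm)
    rw [koszulH_of_max f (Finset.mem_insert_of_mem hm), koszulCoeff_insert_of_lt hsm hs.1,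
      Finset.erase_insert_of_ne hsm.ne, map_smul, divLast_mul_of_gt hb hy hsm,
      koszulCoeff_erase_of_le hsm.le, smul_mul_assoc]
    · simp only [smul_smul]
      rw [← add_smul]
      have := hq m s
      rw [show koszulCoeff q s S * (-(q m s)⁻¹ * koszulCoeff q m S)⁻¹ +
        (koszulCoeff q m S)⁻¹ * (koszulCoeff q s S * q m s) = 0 by field_simp; ring, zero_smul]
    · intro t ht
      rcases Finset.mem_insert.1 ht with rfl | ht
      · exact hsm.le
      · exact hmax t ht
  -- Here `s > m` becomes the new maximum, and `divLast b m` kills the contribution of the second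
  -- term.
  · intro s hs
    have hms := Finset.mem_Ioi.1 hs
    rw [koszulH_insert_of_lt hq f fun t ht => (hmax t ht).trans_lt hms, map_smul,
      divLast_mul_of_lt hb hy hms, smul_zero, smul_zero, add_zero]

end Complex

/-! ### Cutting the complex by cardinality into a linear resolution. -/

section Resolution

variable {K B : Type*} [Field K] [Ring B] [Algebra K B] {n : ℕ}

/-- Extension by zero of a family indexed by the subsets with `i` elements. -/
def extendCard (i : ℕ) :
    ({S : Finset (Fin n) // S.card = i} →₀ B) →ₗ[B] (Finset (Fin n) → B) where
  toFun f S := if h : S.card = i then f ⟨S, h⟩ else 0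
  map_add' f g := by ext S; by_cases h : S.card = i <;> simp [h]
  map_smul' c f := by ext S; by_cases h : S.card = i <;> simp [h]

/-- Restriction to the subsets with `i` elements. -/
noncomputable def restrictCard (i : ℕ) :
    (Finset (Fin n) → B) →ₗ[B] ({S : Finset (Fin n) // S.card = i} →₀ B) :=
  (Finsupp.linearEquivFunOnFinite B B {S : Finset (Fin n) // S.card = i}).symm.toLinearMap ∘ₗ
    LinearMap.funLeft B B Subtype.val

@[simp] lemma restrictCard_apply (i : ℕ) (f : Finset (Fin n) → B)
    (S : {S : Finset (Fin n) // S.card = i}) : restrictCard i f S = f S := rfl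

lemma extendCard_apply {i : ℕ} (f : {S : Finset (Fin n) // S.card = i} →₀ B)
    {S : Finset (Fin n)} (h : S.card = i) : extendCard i f S = f ⟨S, h⟩ := dif_pos h

lemma extendCard_of_ne {i : ℕ} (f : {S : Finset (Fin n) // S.card = i} →₀ B)
    {S : Finset (Fin n)} (h : S.card ≠ i) : extendCard i f S = 0 := dif_neg h

lemma extendCard_restrictCard {i : ℕ} {f : Finset (Fin n) → B} (hf : ∀ S, S.card ≠ i → f S = 0) :
    extendCard i (restrictCard i f) = f := by
  ext S
  by_cases h : S.card = i
  · rw [extendCard_apply _ h, restrictCard_apply]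
  · rw [extendCard_of_ne _ h, hf S h]

variable {y : Fin n → B} {q : Fin n → Fin n → K} {b : Module.Basis (Fin n → ℕ) K B}

lemma koszulD_extendCard_of_ne {i : ℕ} (f : {S : Finset (Fin n) // S.card = i + 1} →₀ B)
    {S : Finset (Fin n)} (h : S.card ≠ i) : koszulD y q (extendCard (i + 1) f) S = 0 := by
  refine Finset.sum_eq_zero fun s hs => ?_
  rw [extendCard_of_ne, zero_mul, smul_zero]
  rw [Finset.card_insert_of_notMem (Finset.mem_compl.1 hs)]
  omega

lemma koszulH_extendCard_of_ne {i : ℕ} (f : {S : Finset (Fin n) // S.card = i} →₀ B)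
    {S : Finset (Fin n)} (h : S.card ≠ i + 1) : koszulH b q (extendCard i f) S = 0 := by
  rw [koszulH]
  split_ifs with hS
  · rw [extendCard_of_ne, map_zero, smul_zero]
    have := Finset.card_erase_add_one (S.max'_mem hS)
    omega
  · rfl

/-- The differential of the Koszul complex in degree `i + 1`. -/
noncomputable def koszulDiff (y : Fin n → B) (q : Fin n → Fin n → K) (i : ℕ) :
    ({S : Finset (Fin n) // S.card = i + 1} →₀ B) →ₗ[B]
      ({S : Finset (Fin n) // S.card = i} →₀ B) :=
  restrictCard i ∘ₗ koszulD y q ∘ₗ extendCard (i + 1)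

lemma extendCard_koszulDiff {i : ℕ} (f : {S : Finset (Fin n) // S.card = i + 1} →₀ B) :
    extendCard i (koszulDiff y q i f) = koszulD y q (extendCard (i + 1) f) :=
  extendCard_restrictCard fun _ h => koszulD_extendCard_of_ne f h

lemma koszulDiff_restrictCard_koszulH {i : ℕ} (f : {S : Finset (Fin n) // S.card = i} →₀ B) :
    koszulDiff y q i (restrictCard (i + 1) (koszulH b q (extendCard i f))) =
      restrictCard i (koszulD y q (koszulH b q (extendCard i f))) := by
  rw [koszulDiff, LinearMap.comp_apply, LinearMap.comp_apply,
    extendCard_restrictCard fun _ h => koszulH_extendCard_of_ne f h]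

lemma exact_koszulDiff (hq : ∀ i j, q i j ≠ 0) (hb : ∀ α, b α = stdMonomial y α)
    (hy : ∀ i j, y i * y j = q i j • (y j * y i)) (i : ℕ) :
    Function.Exact (koszulDiff y q (i + 1)) (koszulDiff y q i) := by
  intro f
  constructor
  · intro hf
    refine ⟨restrictCard (i + 2) (koszulH b q (extendCard (i + 1) f)), ?_⟩
    rw [koszulDiff_restrictCard_koszulH]
    ext S
    have hS : (S : Finset (Fin n)).Nonempty := Finset.card_pos.1 (by rw [S.2]; omega)
    -- For a cycle the term with `koszulH` outermost vanishes, leaving `f` as the boundary of its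
    -- image under `koszulH`.
    have hH := koszulD_koszulH_add hq hb hy (extendCard (i + 1) f) hS
    rw [← extendCard_koszulDiff, hf, map_zero] at hH
    have h0 : koszulH b q (0 : Finset (Fin n) → B) S = 0 := by simp [koszulH]
    rw [h0, add_zero, extendCard_apply _ S.2] at hH
    exact hH
  · rintro ⟨g, rfl⟩
    rw [koszulDiff, LinearMap.comp_apply, LinearMap.comp_apply, extendCard_koszulDiff,
      koszulD_koszulD hq hy, map_zero]

lemma word_mul_gen_mem {𝒜 : ℕ → Submodule K B}
    (h𝒜 : ∀ j, 𝒜 j = Submodule.span K {a | ∃ w : List (Fin n), w.length = j ∧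
      (w.map y).prod = a}) {j : ℕ} {a : B} (ha : a ∈ 𝒜 j) (s : Fin n) :
    a * y s ∈ 𝒜 (j + 1) := by
  rw [h𝒜] at ha ⊢
  induction ha using Submodule.span_induction with
  | mem a h =>
    obtain ⟨w, hw, rfl⟩ := h
    exact Submodule.subset_span ⟨w ++ [s], by simp [hw], by simp⟩
  | zero => simp
  | add a b _ _ ha hb => rw [add_mul]; exact add_mem ha hb
  | smul c a _ ha => rw [smul_mul_assoc]; exact Submodule.smul_mem _ _ ha

lemma augOfBasis_of_mem {𝒜 : ℕ → Submodule K B} (hb : ∀ α, b α = stdMonomial y α)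
    (hy : ∀ i j, y i * y j = q i j • (y j * y i))
    (h𝒜 : ∀ j, 𝒜 j = Submodule.span K {a | ∃ w : List (Fin n), w.length = j ∧
      (w.map y).prod = a}) {j : ℕ} (hj : 0 < j) {a : B} (ha : a ∈ 𝒜 j) :
    augOfBasis hb hy a = 0 := by
  rw [h𝒜] at ha
  induction ha using Submodule.span_induction with
  | mem a h =>
    obtain ⟨w, hw, rfl⟩ := h
    cases w with
    | nil => simp at hw; omega
    | cons i w =>
      have : augOfBasis hb hy (y i) = 0 := by
        rw [← stdMonomial_single y, ← hb]
        exact augOfBasis_basis hb hy fun h => by simpa using congrFun h i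
      simp [this]
  | zero => simp
  | add a b _ _ ha hb => rw [map_add, ha, hb, add_zero]
  | smul c a _ ha => rw [map_smul, ha, smul_zero]

/-- Removing one index lowers the degree of the basis element by 1, while multiplying by one
generator raises that of the coefficient by 1. -/
lemma koszulDiff_mem_shiftedFreePart {𝒜 : ℕ → Submodule K B}
    (h𝒜 : ∀ j, 𝒜 j = Submodule.span K {a | ∃ w : List (Fin n), w.length = j ∧
      (w.map y).prod = a}) (i j : ℕ) (f : {S : Finset (Fin n) // S.card = i + 1} →₀ B)
    (hf : f ∈ shiftedFreePart 𝒜 {S : Finset (Fin n) // S.card = i + 1} (i + 1) j) :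
    koszulDiff y q i f ∈ shiftedFreePart 𝒜 {S : Finset (Fin n) // S.card = i} i j := by
  intro S
  -- Truncated subtraction gives `j - i = j - (i + 1) + 1` only in this range; below it `f` is zero.
  by_cases hij : i + 1 ≤ j
  · refine Or.inl ⟨by omega, Submodule.sum_mem _ fun s hs => Submodule.smul_mem _ _ ?_⟩
    have hc : (insert s (S : Finset (Fin n))).card = i + 1 := by
      rw [Finset.card_insert_of_notMem (Finset.mem_compl.1 hs), S.2]
    rw [extendCard_apply _ hc, show j - i = j - (i + 1) + 1 by omega]
    refine word_mul_gen_mem h𝒜 ?_ s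
    rcases hf ⟨_, hc⟩ with h | h
    · exact h.2
    · rw [h]; exact zero_mem _
  · have : f = 0 := by
      ext T
      rcases hf T with h | h
      · exact absurd h.1 hij
      · exact h
    right
    rw [this, map_zero, Finsupp.zero_apply]

theorem hasLinearFreeResolution_of_basis (hb : ∀ α, b α = stdMonomial y α)
    (hq : ∀ i j, q i j ≠ 0) (hy : ∀ i j, y i * y j = q i j • (y j * y i))
    {𝒜 : ℕ → Submodule K B}
    (h𝒜 : ∀ j, 𝒜 j = Submodule.span K {a | ∃ w : List (Fin n), w.length = j ∧
      (w.map y).prod = a}) :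
    HasLinearFreeResolution 𝒜 := by
  let e : {S : Finset (Fin n) // S.card = 0} := ⟨∅, rfl⟩
  have he : ∀ S, S = e := fun S => Subtype.ext (Finset.card_eq_zero.1 S.2)
  refine ⟨augOfBasis hb hy, fun i => {S : Finset (Fin n) // S.card = i}, koszulDiff y q,
    { toFun := fun f => augOfBasis hb hy (f e)
      map_add' := fun f g => by simp
      map_smul' := fun c f => by simp },
    fun j hj a ha => augOfBasis_of_mem hb hy h𝒜 hj ha, koszulDiff_mem_shiftedFreePart h𝒜, ?_, ?_, ?_,
    exact_koszulDiff hq hb hy⟩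
  · intro j hj f hf
    change augOfBasis hb hy (f e) = 0
    rcases hf e with h | h
    · exact augOfBasis_of_mem hb hy h𝒜 hj (by simpa using h.2)
    · rw [h, map_zero]
  · intro c
    refine ⟨Finsupp.single e (algebraMap K B c), ?_⟩
    change augOfBasis hb hy (Finsupp.single e (algebraMap K B c) e) = c
    rw [Finsupp.single_eq_same, AlgHom.commutes]
    rfl
  · intro f
    change augOfBasis hb hy (f e) = 0 ↔ _
    constructor
    · intro hf
      -- At the empty set the homotopy identity misses only the constant term, which is zero by
      -- `hf`.
      refine ⟨restrictCard 1 (koszulH b q (extendCard 0 f)), ?_⟩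
      rw [koszulDiff_restrictCard_koszulH]
      ext S
      rw [he S, restrictCard_apply]
      change koszulD y q _ ∅ = _
      rw [koszulD_koszulH_empty hq hb hy, extendCard_apply f (S := ∅) rfl]
      change f e - algebraMap K B (augOfBasis hb hy (f e)) = f e
      rw [hf, map_zero, sub_zero]
    · rintro ⟨g, rfl⟩
      change augOfBasis hb hy (koszulD y q (extendCard 1 g) ∅) = 0
      rw [koszulD_apply, map_sum]
      refine Finset.sum_eq_zero fun s _ => ?_
      have : augOfBasis hb hy (y s) = 0 := augOfBasis_of_mem hb hy h𝒜 zero_lt_one (by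
        rw [h𝒜]; exact Submodule.subset_span ⟨[s], rfl, by simp⟩)
      rw [map_smul, map_mul, this, mul_zero, smul_zero]

end Resolution

end SkewPBW

namespace SkewPBW

/-! ### Homogeneous elements and words in the associated graded ring. -/

section GrWords

variable {K A : Type*} [CommRing K] [Ring A] [Algebra K A] {n : ℕ}
variable (F : ℕ → Submodule K A)

/-- The class of an element of `F_m`, as a homogeneous element of `Gr(A)`. -/
def grOf (m : ℕ) (a : A) (ha : a ∈ F m) : Gr F := DirectSum.of (GrPiece F) m (grMk F m ⟨a, ha⟩)

lemma grOf_congr {i j : ℕ} {a a' : A} (hij : i = j) (haa : a = a') (ha : a ∈ F i) :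
    grOf F i a ha = grOf F j a' (haa ▸ hij ▸ ha) := by
  subst hij haa
  rfl

lemma grOf_smul {m : ℕ} (c : K) {a : A} (ha : a ∈ F m) :
    grOf F m (c • a) (Submodule.smul_mem _ c ha) = c • grOf F m a ha :=
  map_smul (DirectSum.lof K ℕ (GrPiece F) m ∘ₗ grMk F m) c ⟨a, ha⟩

lemma grOf_zero (m : ℕ) : grOf F m 0 (zero_mem _) = 0 :=
  map_zero (DirectSum.lof K ℕ (GrPiece F) m ∘ₗ grMk F m)

lemma grOf_add {m : ℕ} {a a' : A} (ha : a ∈ F m) (ha' : a' ∈ F m) :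
    grOf F m (a + a') (add_mem ha ha') = grOf F m a ha + grOf F m a' ha' :=
  map_add (DirectSum.lof K ℕ (GrPiece F) m ∘ₗ grMk F m) ⟨a, ha⟩ ⟨a', ha'⟩

lemma grOf_eq_of_sub_mem {m : ℕ} {a a' : A} (ha : a ∈ F m) (ha' : a' ∈ F m)
    (h : a - a' ∈ prevStep F m) : grOf F m a ha = grOf F m a' ha' := by
  rw [grOf, grOf]
  congr 1
  exact (Submodule.Quotient.eq _).2 h

variable [IsRingFiltration F (prevStep F)]

lemma grOf_mul {i j : ℕ} {a a' : A} (ha : a ∈ F i) (ha' : a' ∈ F j) :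
    grOf F i a ha * grOf F j a' ha' =
      grOf F (i + j) (a * a') (SetLike.mul_mem_graded ha ha') :=
  DirectSum.of_mul_of _ _

lemma one_eq_grOf : (1 : Gr F) = grOf F 0 1 (SetLike.one_mem_graded F) := rfl

lemma word_mem_filtration {x : Fin n → A} (hx : ∀ i, x i ∈ F 1) (w : List (Fin n)) :
    (w.map x).prod ∈ F w.length := by
  induction w with
  | nil => simpa using SetLike.one_mem_graded F
  | cons i w ih =>
    rw [List.map_cons, List.prod_cons, List.length_cons, add_comm]
    exact SetLike.mul_mem_graded (hx i) ih

lemma word_grOf {x : Fin n → A} (hx : ∀ i, x i ∈ F 1) (w : List (Fin n)) :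
    (w.map fun i => grOf F 1 (x i) (hx i)).prod =
      grOf F w.length (w.map x).prod (word_mem_filtration F hx w) := by
  induction w with
  | nil => exact one_eq_grOf F
  | cons i w ih =>
    rw [List.map_cons, List.prod_cons, ih, grOf_mul]
    exact grOf_congr F (by simp [add_comm]) (by simp) _

end GrWords

/-! ### The associated graded ring as a quantum affine space. -/

section GrSkewPBW

variable {K A : Type*} [Field K] [Ring A] [Algebra K A] {n : ℕ} {x : Fin n → A}

lemma IsSkewPBWExtension.gen_mem (hx : IsSkewPBWExtension K x) (i : Fin n) :
    x i ∈ degreeFiltration K x 1 := by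
  simpa using word_mem_degreeFiltration hx 1 [i] rfl

lemma IsSkewPBWExtension.span_one_gens_le (hx : IsSkewPBWExtension K x) :
    Submodule.span K (insert (1 : A) (Set.range x)) ≤ degreeFiltration K x 1 := by
  rw [Submodule.span_le]
  rintro _ (rfl | ⟨i, rfl⟩)
  · exact Submodule.subset_span ⟨0, by simp, by simp⟩
  · exact hx.gen_mem i

/-- The coefficient of `x^α` as a functional on `Gr(A)`. -/
lemma exists_grCoord (b : Module.Basis (Fin n → ℕ) K A) (hb : ∀ α, b α = stdMonomial x α)
    (α : Fin n → ℕ) :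
    ∃ φ : Gr (degreeFiltration K x) →ₗ[K] K, ∀ (m : ℕ) (a : A) (ha : a ∈ degreeFiltration K x m),
      φ (grOf _ m a ha) = if m = ∑ i, α i then b.coord α a else 0 := by
  -- The preceding step is spanned by monomials of degree below `|α|`, so none of them is `x^α` and
  -- the coefficient passes to the quotient.
  have hprev : prevStep (degreeFiltration K x) (∑ i, α i) ≤ LinearMap.ker (b.coord α) := by
    rcases hm : ∑ i, α i with _ | m
    · exact bot_le
    · refine Submodule.span_le.2 ?_
      rintro _ ⟨β, hβ, rfl⟩
      have hne : β ≠ α := by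
        rintro rfl
        have : ∑ i, β i ≤ m := hβ
        omega
      simp [← hb, hne]
  let ψ : GrPiece (degreeFiltration K x) (∑ i, α i) →ₗ[K] K :=
    Submodule.liftQ _ (b.coord α ∘ₗ (degreeFiltration K x (∑ i, α i)).subtype)
      (fun a ha => hprev ha)
  refine ⟨ψ ∘ₗ DirectSum.component K ℕ (GrPiece (degreeFiltration K x)) (∑ i, α i), ?_⟩
  intro m a ha
  split_ifs with h
  · subst h
    rw [LinearMap.comp_apply, grOf, ← DirectSum.lof_eq_of K, DirectSum.component.lof_self]
    rfl
  · rw [LinearMap.comp_apply, grOf, ← DirectSum.lof_eq_of K, DirectSum.component.of, dif_neg h,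
      map_zero]

variable [IsRingFiltration (degreeFiltration K x) (prevStep (degreeFiltration K x))]

/-- The classes of the generators in `Gr(A)`. -/
def grGen (hx : IsSkewPBWExtension K x) (i : Fin n) : Gr (degreeFiltration K x) :=
  grOf _ 1 (x i) (hx.gen_mem i)

lemma word_grGen (hx : IsSkewPBWExtension K x) (w : List (Fin n)) :
    (w.map (grGen hx)).prod = grOf _ w.length (w.map x).prod
      (word_mem_degreeFiltration hx _ w rfl) :=
  word_grOf _ hx.gen_mem w

lemma stdMonomial_mem (x : Fin n → A) (α : Fin n → ℕ) :
    stdMonomial x α ∈ degreeFiltration K x (∑ i, α i) :=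
  Submodule.subset_span ⟨α, le_refl (∑ i, α i), rfl⟩

lemma stdMonomial_grGen (hx : IsSkewPBWExtension K x) (α : Fin n → ℕ) :
    stdMonomial (grGen hx) α = grOf _ (∑ i, α i) (stdMonomial x α) (stdMonomial_mem x α) := by
  rw [← stdWord_prod, word_grGen]
  exact grOf_congr _ (stdWord_length α) (stdWord_prod x α) _

lemma exists_grGen_comm (hx : IsSkewPBWExtension K x) (i j : Fin n) :
    ∃ c : K, c ≠ 0 ∧ grGen hx i * grGen hx j = c • (grGen hx j * grGen hx i) := by
  obtain ⟨c, hc, h⟩ := hx.mul_gen j i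
  refine ⟨c, hc, ?_⟩
  rw [grGen, grGen, grOf_mul, grOf_mul, ← grOf_smul]
  -- Both products lie in degree `1 + 1`, whose preceding step is `F_1`; it contains the entire
  -- correction term.
  exact grOf_eq_of_sub_mem _ _ _ (hx.span_one_gens_le h)

lemma grGrading_eq_span (hx : IsSkewPBWExtension K x) (m : ℕ) :
    grGrading (degreeFiltration K x) m = Submodule.span K
      {a | ∃ w : List (Fin n), w.length = m ∧ (w.map (grGen hx)).prod = a} := by
  apply le_antisymm
  · rintro _ ⟨a, rfl⟩
    obtain ⟨⟨a, ha⟩, rfl⟩ := grMk_surjective _ m a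
    change grOf _ m a ha ∈ _
    induction ha using Submodule.span_induction with
    | mem a h =>
      obtain ⟨α, hα, rfl⟩ := h
      rcases eq_or_lt_of_le (show ∑ i, α i ≤ m from hα) with h | h
      · refine Submodule.subset_span ⟨stdWord α, (stdWord_length α).trans h, ?_⟩
        rw [word_grGen]
        exact grOf_congr _ ((stdWord_length α).trans h) (stdWord_prod x α) _
      -- A monomial of degree strictly below `m` already lies in the preceding step, so its class in
      -- degree `m` is zero.
      · have h0 : grOf (degreeFiltration K x) m (stdMonomial x α)
            (degreeFiltration_mono x h.le (stdMonomial_mem x α)) = grOf _ m 0 (zero_mem _) := by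
          refine grOf_eq_of_sub_mem _ _ _ ?_
          rw [sub_zero]
          cases m with
          | zero => omega
          | succ m => exact degreeFiltration_mono x (Nat.lt_succ_iff.1 h) (stdMonomial_mem x α)
        rw [h0, grOf_zero]
        exact zero_mem _
    | zero =>
      rw [grOf_zero]
      exact zero_mem _
    | add a a' ha ha' h h' =>
      have := grOf_add (degreeFiltration K x) ha ha'
      rw [this]
      exact add_mem h h'
    | smul c a ha h =>
      have := grOf_smul (degreeFiltration K x) c ha
      rw [this]
      exact Submodule.smul_mem _ c h
  · rw [Submodule.span_le]
    rintro _ ⟨w, rfl, rfl⟩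
    rw [word_grGen]
    exact ⟨_, rfl⟩

/-- The coefficient functionals of `exists_grCoord` form a dual family to these monomials. -/
lemma linearIndependent_grGen (hx : IsSkewPBWExtension K x) :
    LinearIndependent K (stdMonomial (grGen hx)) := by
  let b := Module.Basis.mk hx.linearIndependent hx.span_eq_top.ge
  have hb : ∀ α, b α = stdMonomial x α := fun α => Module.Basis.mk_apply _ _ α
  choose φ hφ using exists_grCoord b hb
  refine LinearIndependent.of_pairwise_dual_eq_zero_one _ φ ?_ ?_
  · intro α β hαβ
    rw [stdMonomial_grGen, hφ, ← hb]
    simp [hαβ]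
  · intro α
    rw [stdMonomial_grGen, hφ, ← hb]
    simp

lemma span_stdMonomial_grGen (hx : IsSkewPBWExtension K x) :
    Submodule.span K (Set.range (stdMonomial (grGen hx))) = ⊤ := by
  choose q _ hy using exists_grGen_comm hx
  rw [eq_top_iff]
  intro a _
  induction a using DirectSum.induction_on with
  | zero => exact zero_mem _
  | of m a =>
    have ha : DirectSum.of (GrPiece (degreeFiltration K x)) m a ∈
        grGrading (degreeFiltration K x) m := ⟨a, rfl⟩
    rw [grGrading_eq_span hx] at ha
    refine Submodule.span_le.2 ?_ ha
    rintro _ ⟨w, _, rfl⟩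
    obtain ⟨c, hc⟩ := word_eq_smul_stdMonomial hy w
    rw [hc]
    exact Submodule.smul_mem _ _ (Submodule.subset_span ⟨_, rfl⟩)
  | add a a' h h' => exact add_mem (h trivial) (h' trivial)

theorem isHomogeneousKoszul_gr (hx : IsSkewPBWExtension K x) :
    IsHomogeneousKoszul (B := Gr (degreeFiltration K x)) (grGrading (degreeFiltration K x)) := by
  choose q hq hy using exists_grGen_comm hx
  let b := Module.Basis.mk (linearIndependent_grGen hx) (span_stdMonomial_grGen hx).ge
  have hb : ∀ α, b α = stdMonomial (grGen hx) α := fun α => Module.Basis.mk_apply _ _ α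
  exact ⟨isHomogeneousPreKoszul_of_basis b hb hy (grGrading_eq_span hx),
    hasLinearFreeResolution_of_basis hb hq hy (grGrading_eq_span hx)⟩

end GrSkewPBW

end SkewPBW

theorem corollary3p15 {K A : Type*} [Field K] [Ring A] [Algebra K A] {n : ℕ} (x : Fin n → A)
    (h : SkewPBW.IsPreCommutative K x) :
    haveI := h.isRingFiltration
    SkewPBW.IsHomogeneousKoszul (B := SkewPBW.Gr (SkewPBW.degreeFiltration K x))
      (SkewPBW.grGrading (SkewPBW.degreeFiltration K x)) := by
  have := h.isRingFiltration
  exact SkewPBW.isHomogeneousKoszul_gr h.toIsSkewPBWExtension
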